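/- Let $\Sigma$ be a closed (compact, without boundary) connected smooth surface, and let $\pi\colon M^3\to\Sigma$ be any smooth principal $S^1$-bundle. (This includes $\Sigma=\Sigma_g$, the closed oriented surface of genus $g$, and $M^3=M^3_g(n)$, the principal circle bundle over $\Sigma_g$ with Euler class $n$, for all $g$ and $n$.) Let $\ell_2,w_1,w_2$ be positive integers with $\gcd(w_1,w_2)=1$ and $\gcd(\ell_2,w_1w_2)=1$. Regard $S^3$ as the unit sphere of $\mathbb C^2$, let $S^1\subset\mathbb C$ act on $M^3\times S^3$ by $$z\cdot\bigl(u,(z_1,z_2)\bigr)=\bigl(z^{-\ell_2}u,\,(z^{w_1}z_1,z^{w_2}z_2)\bigr),$$ and let the join $M^3\star_{\ell_1,\ell_2}S^3_{\mathbf w}$ (where $\ell_1=1$) be the orbit space of this action. Let $p_0\colon M^3\star_{\ell_1,\ell_2}S^3_{\mathbf w}\to\Sigma$ be the map $[u,(z_1,z_2)]\mapsto\pi(u)$. Let the lens space $L(\ell_2;w_1,w_2)$ be the orbit space of $S^3$ under the action $\zeta\cdot(z_1,z_2)=(\zeta^{w_1}z_1,\zeta^{w_2}z_2)$ of the group of $\ell_2$-th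 roots of unity. Then $M^3\star_{\ell_1,\ell_2}S^3_{\mathbf w}$ and $L(\ell_2;w_1,w_2)$ with their quotient topologies are Hausdorff, second countable, and carry (necessarily unique) structures of smooth manifolds, of dimensions $5$ and $3$, for which the quotient maps from $M^3\times S^3$ and from $S^3$ are smooth submersions. With these structures $p_0$ is a smooth fiber bundle with fiber $L(\ell_2;w_1,w_2)$: every point of $\Sigma$ has an open neighbourhood $U$ with a diffeomorphism $p_0^{-1}(U)\cong U\times L(\ell_2;w_1,w_2)$ commuting with the projections to $U$. -/

import Mathlib

open scoped Manifold ContDiff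

noncomputable section

/-- A map `p : M → B` of smooth manifolds is the projection of a smooth fibre bundle with fibre
the manifold `F`: over a neighbourhood `U` of each point of `B` there is a diffeomorphism
`p⁻¹(U) ≅ U × F` over `U`. -/
def IsSmoothFiberBundle
    {EM HM EB HB EF HF : Type*}
    [NormedAddCommGroup EM] [NormedSpace ℝ EM] [TopologicalSpace HM]
    [NormedAddCommGroup EB] [NormedSpace ℝ EB] [TopologicalSpace HB]
    [NormedAddCommGroup EF] [NormedSpace ℝ EF] [TopologicalSpace HF]
    (IM : ModelWithCorners ℝ EM HM) (IB : ModelWithCorners ℝ EB HB)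
    (IF : ModelWithCorners ℝ EF HF)
    {M B : Type*} (F : Type*)
    [TopologicalSpace M] [ChartedSpace HM M]
    [TopologicalSpace B] [ChartedSpace HB B]
    [TopologicalSpace F] [ChartedSpace HF F]
    (p : M → B) : Prop :=
  ∀ b : B, ∃ e : Bundle.Trivialization F p, b ∈ e.baseSet ∧
    ContMDiffOn IM (IB.prod IF) ∞ e e.source ∧
    ContMDiffOn (IB.prod IF) IM ∞ e.toOpenPartialHomeomorph.symm e.target

/-- A map `π : P → B` from a manifold with a circle action is the projection of a smooth principal
circle bundle: over a neighbourhood `U` of each point of `B` there is a diffeomorphism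
`π⁻¹(U) ≅ U × S¹` over `U` that carries the action to multiplication on `S¹`.
(Freeness and smoothness of the action follow, and so does that its orbits are the fibres.) -/
def IsSmoothPrincipalCircleBundle
    {EP HP EB HB : Type*}
    [NormedAddCommGroup EP] [NormedSpace ℝ EP] [TopologicalSpace HP]
    [NormedAddCommGroup EB] [NormedSpace ℝ EB] [TopologicalSpace HB]
    (IP : ModelWithCorners ℝ EP HP) (IB : ModelWithCorners ℝ EB HB)
    {P B : Type*}
    [TopologicalSpace P] [ChartedSpace HP P] [MulAction Circle P]
    [TopologicalSpace B] [ChartedSpace HB B]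
    (π : P → B) : Prop :=
  ∀ b : B, ∃ e : Bundle.Trivialization Circle π, b ∈ e.baseSet ∧
    ContMDiffOn IP (IB.prod (𝓡 1)) ∞ e e.source ∧
    ContMDiffOn (IB.prod (𝓡 1)) IP ∞ e.toOpenPartialHomeomorph.symm e.target ∧
    ∀ x ∈ e.source, ∀ z : Circle,
      z • x ∈ e.source ∧ e (z • x) = ((e x).1, z * (e x).2)

/-- The circle action preserves the fibres of a principal circle bundle. -/
theorem IsSmoothPrincipalCircleBundle.proj_smul
    {EP HP EB HB : Type*}
    [NormedAddCommGroup EP] [NormedSpace ℝ EP] [TopologicalSpace HP]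
    [NormedAddCommGroup EB] [NormedSpace ℝ EB] [TopologicalSpace HB]
    {IP : ModelWithCorners ℝ EP HP} {IB : ModelWithCorners ℝ EB HB}
    {P B : Type*}
    [TopologicalSpace P] [ChartedSpace HP P] [MulAction Circle P]
    [TopologicalSpace B] [ChartedSpace HB B]
    {π : P → B} (h : IsSmoothPrincipalCircleBundle IP IB π) (z : Circle) (x : P) :
    π (z • x) = π x := by
  obtain ⟨e, hb, -, -, he⟩ := h (π x)
  have hx : x ∈ e.source := e.mem_source.2 hb
  obtain ⟨h1, h2⟩ := he x hx z
  rw [← e.coe_fst h1, h2, e.coe_fst hx]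

/-- `q : X → Y` exhibits `Y` as a quotient manifold of `X`: `Y` is a Hausdorff, second countable
smooth manifold with the quotient topology and `q` is a surjective smooth submersion.
The smooth structure of `Y` is uniquely determined by this. -/
structure IsQuotientManifold
    {EX HX EY HY : Type*}
    [NormedAddCommGroup EX] [NormedSpace ℝ EX] [TopologicalSpace HX]
    [NormedAddCommGroup EY] [NormedSpace ℝ EY] [TopologicalSpace HY]
    (IX : ModelWithCorners ℝ EX HX) (IY : ModelWithCorners ℝ EY HY)
    {X Y : Type*}
    [TopologicalSpace X] [ChartedSpace HX X]
    [TopologicalSpace Y] [ChartedSpace HY Y]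
    (q : X → Y) : Prop where
  t2 : T2Space Y
  secondCountable : SecondCountableTopology Y
  isManifold : IsManifold IY ∞ Y
  isQuotientMap : Topology.IsQuotientMap q
  contMDiff : ContMDiff IX IY ∞ q
  submersion : ∀ x : X, Function.Surjective (mfderiv IX IY q x)

/-- The Hermitian space `ℂ²`. -/
abbrev C2 : Type := EuclideanSpace ℂ (Fin 2)

instance fact_finrank_C2 : Fact (Module.finrank ℝ C2 = 3 + 1) :=
  ⟨by rw [finrank_real_of_complex, finrank_euclideanSpace_fin]⟩

/-- The unit sphere `S³ ⊂ ℂ²`, with Mathlib's smooth structure. -/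
abbrev S3 : Type := Metric.sphere (0 : C2) 1

/-- The map `(z₁, z₂) ↦ (z^w₁ z₁, z^w₂ z₂)` of `S³`. -/
def weightedRotation (w₁ w₂ : ℕ) (z : Circle) (v : S3) : S3 :=
  ⟨!₂[(z : ℂ) ^ w₁ * v.1 0, (z : ℂ) ^ w₂ * v.1 1], by
    have hv : ‖v.1‖ = 1 := mem_sphere_zero_iff_norm.1 v.2
    have hz : ‖(z : ℂ)‖ = 1 := Circle.norm_coe z
    rw [EuclideanSpace.norm_eq] at hv
    rw [mem_sphere_zero_iff_norm, EuclideanSpace.norm_eq]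
    simpa [Fin.sum_univ_two, hz] using hv⟩

/-- The weighted circle action `z · (z₁, z₂) = (z^w₁ z₁, z^w₂ z₂)` on `S³`. -/
@[reducible] def weightedAction (w₁ w₂ : ℕ) : MulAction Circle S3 where
  smul := weightedRotation w₁ w₂
  one_smul v := by
    change weightedRotation w₁ w₂ 1 v = v
    ext i; fin_cases i <;> simp [weightedRotation]
  mul_smul a b v := by
    change weightedRotation w₁ w₂ (a * b) v =
      weightedRotation w₁ w₂ a (weightedRotation w₁ w₂ b v)
    ext i; fin_cases i <;> simp [weightedRotation, mul_pow, mul_assoc]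

/-- The subgroup of `l`-th roots of unity of the circle. -/
def circleRoots (l : ℕ) : Subgroup Circle := (powMonoidHom l : Circle →* Circle).ker

/-- The orbit relation on `S³` of the `l`-th roots of unity acting by
`ζ · (z₁, z₂) = (ζ^w₁ z₁, ζ^w₂ z₂)`. -/
def lensSetoid (l w₁ w₂ : ℕ) : Setoid S3 :=
  letI := weightedAction w₁ w₂
  MulAction.orbitRel (circleRoots l) S3

theorem lensSetoid_iff (l w₁ w₂ : ℕ) (v v' : S3) :
    lensSetoid l w₁ w₂ v v' ↔ ∃ ζ : Circle, ζ ^ l = 1 ∧ weightedRotation w₁ w₂ ζ v' = v :=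
  ⟨fun ⟨ζ, h⟩ => ⟨ζ.1, MonoidHom.mem_ker.1 ζ.2, h⟩,
    fun ⟨ζ, hζ, h⟩ => ⟨⟨ζ, MonoidHom.mem_ker.2 hζ⟩, h⟩⟩

/-- The lens space `L(l; w₁, w₂)`, as a topological space. -/
def LensSpace (l w₁ w₂ : ℕ) : Type := Quotient (lensSetoid l w₁ w₂)

instance (l w₁ w₂ : ℕ) : TopologicalSpace (LensSpace l w₁ w₂) :=
  inferInstanceAs (TopologicalSpace (Quotient (lensSetoid l w₁ w₂)))

/-- The quotient map `S³ → L(l; w₁, w₂)`. -/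
def LensSpace.mk (l w₁ w₂ : ℕ) (v : S3) : LensSpace l w₁ w₂ :=
  Quotient.mk (lensSetoid l w₁ w₂) v

section Join

variable (P : Type*) [MulAction Circle P]

/-- The circle action `z · (u, (z₁, z₂)) = (z^(-l) u, (z^w₁ z₁, z^w₂ z₂))` on `P × S³`. -/
@[reducible] def joinAction (l w₁ w₂ : ℕ) : MulAction Circle (P × S3) where
  smul z x := ((z ^ l)⁻¹ • x.1, weightedRotation w₁ w₂ z x.2)
  one_smul x := by
    refine Prod.ext ?_ ((weightedAction w₁ w₂).one_smul x.2)
    change ((1 : Circle) ^ l)⁻¹ • x.1 = x.1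
    simp
  mul_smul a b x := by
    refine Prod.ext ?_ ((weightedAction w₁ w₂).mul_smul a b x.2)
    change ((a * b) ^ l)⁻¹ • x.1 = (a ^ l)⁻¹ • (b ^ l)⁻¹ • x.1
    rw [smul_smul, mul_pow, mul_inv]

/-- The orbit relation of `joinAction`. -/
def joinSetoid (l w₁ w₂ : ℕ) : Setoid (P × S3) :=
  letI := joinAction P l w₁ w₂
  MulAction.orbitRel Circle (P × S3)

theorem joinSetoid_iff (l w₁ w₂ : ℕ) (x y : P × S3) :
    joinSetoid P l w₁ w₂ x y ↔
      ∃ z : Circle, ((z ^ l)⁻¹ • y.1, weightedRotation w₁ w₂ z y.2) = x :=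
  Iff.rfl

/-- The join `P ⋆ S³_w`, the orbit space of `P × S³` under `joinAction`. -/
def SasakiJoin (l w₁ w₂ : ℕ) : Type _ := Quotient (joinSetoid P l w₁ w₂)

instance [TopologicalSpace P] (l w₁ w₂ : ℕ) : TopologicalSpace (SasakiJoin P l w₁ w₂) :=
  inferInstanceAs (TopologicalSpace (Quotient (joinSetoid P l w₁ w₂)))

/-- The quotient map `P × S³ → P ⋆ S³_w`. -/
def SasakiJoin.mk (l w₁ w₂ : ℕ) (x : P × S3) : SasakiJoin P l w₁ w₂ :=
  Quotient.mk (joinSetoid P l w₁ w₂) x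

end Join

/-- The projection `p₀ : P ⋆ S³_w → B`, `[u, v] ↦ π(u)`, for a map `π` that is constant on the
orbits of the circle. -/
def SasakiJoin.proj {P B : Type*} [MulAction Circle P] {π : P → B}
    (hπ : ∀ (z : Circle) (u : P), π (z • u) = π u) (l w₁ w₂ : ℕ) :
    SasakiJoin P l w₁ w₂ → B :=
  Quotient.lift (s := joinSetoid P l w₁ w₂) (fun x : P × S3 => π x.1) (by
    let _ := joinAction P l w₁ w₂
    rintro x y ⟨z, rfl⟩
    exact hπ _ _)

end

/-! ### Smooth structures on quotient spaces -/

open Filter Set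
open scoped Topology

/-! Over an open `U` on which the circle bundle is trivial, the action on `U × S¹ × S³` is `z · (b,
s, v) = (b, z^(-l) s, z · v)`. Every orbit meets the slice `s = 1`, and the elements that carry a
point of the slice back into it are the `l`-th roots of unity. So the orbit space over `U` is `U ×
L(l; w₁, w₂)`, by `[b, s, v] ↦ (b, [ζ · v])` with `ζ ^ l = s`; another root `ζ` gives the same
class. This is `exists_trivialization_sasakiJoin`. Smoothness comes from local smooth roots,
`Circle.exists_contMDiffAt_root`.

Coprimality of `l` and `w₁ w₂` makes the roots of unity act freely on `S³`, so that `S³ → L(l; w₁,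
w₂)` is a covering map.

Both smooth structures come from `exists_isQuotientManifold`. Local homeomorphisms `Ψ` to a known
manifold are declared smooth, and their compatibility is tested upstairs: if `σ` is a smooth local
lift of `Ψ⁻¹` through the quotient map `q`, then `Ψ' ∘ Ψ⁻¹ = (Ψ' ∘ q) ∘ σ`. For the lens space the
`Ψ` are local inverses of the covering; for the join they are the trivializations, which are then
diffeomorphisms by construction. -/

/-- A boundaryless manifold has smooth charts with values in any vector space that is isomorphic to
its model vector space. -/
theorem exists_contMDiffOn_chart
    {EN HN E N : Type*}
    [NormedAddCommGroup EN] [NormedSpace ℝ EN] [TopologicalSpace HN]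
    [NormedAddCommGroup E] [NormedSpace ℝ E]
    (IN : ModelWithCorners ℝ EN HN) [IN.Boundaryless]
    [TopologicalSpace N] [ChartedSpace HN N] [IsManifold IN ∞ N]
    (L : EN ≃L[ℝ] E) (n : N) :
    ∃ c : OpenPartialHomeomorph N E, n ∈ c.source ∧
      ContMDiffOn IN 𝓘(ℝ, E) ∞ c c.source ∧ ContMDiffOn 𝓘(ℝ, E) IN ∞ c.symm c.target := by
  refine ⟨chartAt HN n ≫ₕ (IN.toHomeomorph.trans L.toHomeomorph).toOpenPartialHomeomorph,
    by simp, ?_, ?_⟩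
  · have h : ContMDiffOn IN 𝓘(ℝ, E) ∞ (L ∘ extChartAt IN n) (chartAt HN n).source :=
      L.contDiff.contMDiff.comp_contMDiffOn contMDiffOn_extChartAt
    refine (h.mono (by simp)).congr fun x _ => ?_
    simp [extChartAt, OpenPartialHomeomorph.extend]
  · have h : ContMDiffOn 𝓘(ℝ, E) IN ∞ ((extChartAt IN n).symm ∘ L.symm)
        (L.symm ⁻¹' (extChartAt IN n).target) :=
      (contMDiffOn_extChartAt_symm n).comp L.symm.contDiff.contMDiff.contMDiffOn fun _ hx => hx
    refine (h.mono fun x hx => ?_).congr fun x _ => ?_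
    · simpa [extChartAt_target, ModelWithCorners.Boundaryless.range_eq_univ] using hx
    · simp [extChartAt, OpenPartialHomeomorph.extend]

/-- A family of local homeomorphisms to a manifold, whose transition maps are smooth, defines a
smooth structure for which these local homeomorphisms are local diffeomorphisms. -/
theorem exists_isManifold_of_transition
    {EN HN E N Y : Type*}
    [NormedAddCommGroup EN] [NormedSpace ℝ EN] [TopologicalSpace HN]
    [NormedAddCommGroup E] [NormedSpace ℝ E]
    (IN : ModelWithCorners ℝ EN HN) [IN.Boundaryless]
    [TopologicalSpace N] [ChartedSpace HN N] [IsManifold IN ∞ N] [TopologicalSpace Y]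
    (L : EN ≃L[ℝ] E) (Ψ : Y → OpenPartialHomeomorph Y N) (hmem : ∀ y, y ∈ (Ψ y).source)
    (htrans : ∀ y y' n, n ∈ (Ψ y).target → (Ψ y).symm n ∈ (Ψ y').source →
      ContMDiffAt IN IN ∞ (Ψ y' ∘ (Ψ y).symm) n) :
    ∃ _ : ChartedSpace E Y, IsManifold 𝓘(ℝ, E) ∞ Y ∧
      ∀ y, ContMDiffOn 𝓘(ℝ, E) IN ∞ (Ψ y) (Ψ y).source ∧
        ContMDiffOn IN 𝓘(ℝ, E) ∞ (Ψ y).symm (Ψ y).target := by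
  choose c hc hcs hct using exists_contMDiffOn_chart (N := N) IN L
  let e : Y → OpenPartialHomeomorph Y E := fun y => Ψ y ≫ₕ c (Ψ y y)
  have he : ∀ y, y ∈ (e y).source := fun y => by simp [e, hmem, hc]
  let cs : ChartedSpace E Y :=
    { atlas := range e
      chartAt := e
      mem_chart_source := he
      chart_mem_atlas := mem_range_self }
  have hcs' : ∀ m n, n ∈ (c m).source → ContMDiffAt IN 𝓘(ℝ, E) ∞ (c m) n := fun m n hn =>
    (hcs m).contMDiffAt ((c m).open_source.mem_nhds hn)
  have hct' : ∀ m v, v ∈ (c m).target → ContMDiffAt 𝓘(ℝ, E) IN ∞ (c m).symm v := fun m v hv =>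
    (hct m).contMDiffAt ((c m).open_target.mem_nhds hv)
  have hmf : IsManifold 𝓘(ℝ, E) ∞ Y := by
    refine isManifold_of_contDiffOn _ _ _ ?_
    rintro _ _ ⟨y, rfl⟩ ⟨y', rfl⟩ v hv
    simp only [e, mfld_simps] at hv
    obtain ⟨⟨h1, h2⟩, h3, h4⟩ := hv
    refine ContDiffAt.contDiffWithinAt ?_
    rw [← contMDiffAt_iff_contDiffAt]
    have := (hcs' (Ψ y' y') _ h4).comp v ((htrans y y' _ h2 h3).comp v (hct' _ _ h1))
    exact this
  refine ⟨cs, hmf, fun y => ⟨fun z hz => ?_, fun n hn => ?_⟩⟩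
  -- The preferred chart at `z` is built from `Ψ z`, not from `Ψ y`. Near `z`, therefore, `Ψ y` is
  -- written as `(Ψ y ∘ (Ψ z)⁻¹) ∘ c⁻¹ ∘ e z`, where `htrans` controls the first factor.
  · have h1 : ContMDiffAt 𝓘(ℝ, E) 𝓘(ℝ, E) ∞ (e z) z :=
      contMDiffAt_of_mem_maximalAtlas (I := 𝓘(ℝ, E)) (IsManifold.chart_mem_maximalAtlas z) (he z)
    have h2 : ContMDiffAt 𝓘(ℝ, E) IN ∞ ((c (Ψ z z)).symm) (e z z) :=
      hct' _ _ ((c (Ψ z z)).map_source (hc _))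
    have h0 : (c (Ψ z z)).symm (e z z) = Ψ z z := (c (Ψ z z)).left_inv (hc _)
    have h3 : ContMDiffAt IN IN ∞ (Ψ y ∘ (Ψ z).symm) ((c (Ψ z z)).symm (e z z)) := by
      rw [h0]
      exact htrans z y _ ((Ψ z).map_source (hmem z)) (by rwa [(Ψ z).left_inv (hmem z)])
    refine ContMDiffAt.contMDiffWithinAt (((h3.comp _ h2).comp _ h1).congr_of_eventuallyEq ?_)
    filter_upwards [(e z).open_source.mem_nhds (he z)] with w hw
    simp only [e, mfld_simps] at hw ⊢
    rw [(c _).left_inv hw.2, (Ψ z).left_inv hw.1]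
  · obtain ⟨z, hz⟩ : ∃ z, (Ψ y).symm n = z := ⟨_, rfl⟩
    have h1 : ContMDiffAt IN IN ∞ (Ψ z ∘ (Ψ y).symm) n := htrans y z n hn (hz ▸ hmem _)
    have h2 : ContMDiffAt IN 𝓘(ℝ, E) ∞ (c (Ψ z z)) ((Ψ z ∘ (Ψ y).symm) n) :=
      hcs' _ _ (by simpa [hz] using hc (Ψ z z))
    have h3 : ContMDiffAt 𝓘(ℝ, E) 𝓘(ℝ, E) ∞ (e z).symm
        (c (Ψ z z) ((Ψ z ∘ (Ψ y).symm) n)) := by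
      refine contMDiffAt_symm_of_mem_maximalAtlas (I := 𝓘(ℝ, E))
        (IsManifold.chart_mem_maximalAtlas z) ?_
      simpa [hz, e] using (e z).map_source (he z)
    refine ContMDiffAt.contMDiffWithinAt ((h3.comp n (h2.comp n h1)).congr_of_eventuallyEq ?_)
    have hn' : (Ψ y).symm n ∈ (e z).source := hz ▸ he _
    filter_upwards [((Ψ y).symm.continuousAt hn).preimage_mem_nhds
      ((e z).open_source.mem_nhds hn')] with m hm
    exact ((e z).left_inv hm).symm

/-- Let `q : X → Y` be a map from a manifold, and let a family of local homeomorphisms from `Y` to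
a manifold `N` be given such that `q`, read in them, is smooth and has a smooth local section
through every point. Then `Y` has a smooth structure for which these local homeomorphisms are local
diffeomorphisms and `q` is a smooth submersion. -/
theorem exists_isQuotientManifold
    {EX HX EN HN E X N Y : Type*}
    [NormedAddCommGroup EX] [NormedSpace ℝ EX] [TopologicalSpace HX]
    [NormedAddCommGroup EN] [NormedSpace ℝ EN] [TopologicalSpace HN]
    [NormedAddCommGroup E] [NormedSpace ℝ E]
    (IX : ModelWithCorners ℝ EX HX) (IN : ModelWithCorners ℝ EN HN) [IN.Boundaryless]
    [TopologicalSpace X] [ChartedSpace HX X]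
    [TopologicalSpace N] [ChartedSpace HN N] [IsManifold IN ∞ N] [TopologicalSpace Y]
    [T2Space Y] [SecondCountableTopology Y]
    (L : EN ≃L[ℝ] E) {q : X → Y} (hq : Topology.IsQuotientMap q)
    (Ψ : Y → OpenPartialHomeomorph Y N) (hmem : ∀ y, y ∈ (Ψ y).source)
    (hsmooth : ∀ y x, q x ∈ (Ψ y).source → ContMDiffAt IX IN ∞ (Ψ y ∘ q) x)
    (hsection : ∀ y x, q x ∈ (Ψ y).source → ∃ σ : N → X, σ (Ψ y (q x)) = x ∧
      ContMDiffAt IN IX ∞ σ (Ψ y (q x)) ∧ ∀ᶠ n in 𝓝 (Ψ y (q x)), q (σ n) = (Ψ y).symm n) :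
    ∃ _ : ChartedSpace E Y, IsQuotientManifold IX 𝓘(ℝ, E) q ∧
      (∀ y, ContMDiffOn 𝓘(ℝ, E) IN ∞ (Ψ y) (Ψ y).source ∧
        ContMDiffOn IN 𝓘(ℝ, E) ∞ (Ψ y).symm (Ψ y).target) ∧
      ∀ x, ∃ τ : Y → X, τ (q x) = x ∧ ContMDiffAt 𝓘(ℝ, E) IX ∞ τ (q x) ∧
        ∀ᶠ y in 𝓝 (q x), q (τ y) = y := by
  obtain ⟨cs, hmf, hΨ⟩ := exists_isManifold_of_transition IN L Ψ hmem (by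
    intro y y' n hn hn'
    obtain ⟨x, hx⟩ := hq.surjective ((Ψ y).symm n)
    have hxy : q x ∈ (Ψ y).source := hx ▸ (Ψ y).map_target hn
    have hxn : Ψ y (q x) = n := by rw [hx, (Ψ y).right_inv hn]
    obtain ⟨σ, h1, h2, h3⟩ := hsection y x hxy
    rw [hxn] at h1 h2 h3
    -- Near `n` the transition map is `(Ψ y' ∘ q) ∘ σ`, since `q ∘ σ = (Ψ y)⁻¹` there.
    have h4 : ContMDiffAt IX IN ∞ (Ψ y' ∘ q) (σ n) := h1 ▸ hsmooth y' x (hx ▸ hn')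
    refine (h4.comp n h2).congr_of_eventuallyEq ?_
    filter_upwards [h3] with m hm
    simp [hm])
  have hqs : ContMDiff IX 𝓘(ℝ, E) ∞ q := fun x => by
    have h1 := hsmooth (q x) x (hmem _)
    have h2 : ContMDiffAt IN 𝓘(ℝ, E) ∞ (Ψ (q x)).symm ((Ψ (q x) ∘ q) x) :=
      (hΨ (q x)).2.contMDiffAt
        ((Ψ (q x)).open_target.mem_nhds ((Ψ (q x)).map_source (hmem _)))
    refine (h2.comp x h1).congr_of_eventuallyEq ?_
    filter_upwards [hq.continuous.continuousAt.preimage_mem_nhds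
      ((Ψ (q x)).open_source.mem_nhds (hmem (q x)))] with w hw
    exact ((Ψ (q x)).left_inv hw).symm
  have hτ : ∀ x, ∃ τ : Y → X, τ (q x) = x ∧ ContMDiffAt 𝓘(ℝ, E) IX ∞ τ (q x) ∧
      ∀ᶠ y in 𝓝 (q x), q (τ y) = y := fun x => by
    obtain ⟨σ, h1, h2, h3⟩ := hsection (q x) x (hmem _)
    have h4 : ContMDiffAt 𝓘(ℝ, E) IN ∞ (Ψ (q x)) (q x) :=
      (hΨ (q x)).1.contMDiffAt ((Ψ (q x)).open_source.mem_nhds (hmem _))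
    refine ⟨σ ∘ Ψ (q x), h1, h2.comp _ h4, ?_⟩
    filter_upwards [((Ψ (q x)).continuousAt (hmem _)).eventually h3,
      (Ψ (q x)).open_source.mem_nhds (hmem (q x))] with w hw hw'
    rw [Function.comp_apply, hw, (Ψ (q x)).left_inv hw']
  refine ⟨cs, ⟨inferInstance, inferInstance, hmf, hq, hqs, fun x => ?_⟩, hΨ, hτ⟩
  -- Differentiating `q ∘ τ = id` at `q x` gives a right inverse of the derivative of `q` at `x`.
  obtain ⟨τ, h1, h2, h3⟩ := hτ x
  have h4 : (q ∘ τ) =ᶠ[𝓝 (q x)] id := h3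
  have h5 := h4.mfderiv_eq (I := 𝓘(ℝ, E)) (I' := 𝓘(ℝ, E))
  rw [mfderiv_comp (q x) ((hqs _).mdifferentiableAt (by simp)) (h2.mdifferentiableAt (by simp)),
    mfderiv_id, h1] at h5
  intro v
  exact ⟨_, DFunLike.congr_fun h5 v⟩

/-! ### The weighted action and roots in the circle -/

/-- The weighted circle action on `S³` is smooth. -/
theorem contMDiff_weightedRotation (w₁ w₂ : ℕ) :
    ContMDiff ((𝓡 1).prod (𝓡 3)) (𝓡 3) ∞
      (fun p : Circle × S3 => weightedRotation w₁ w₂ p.1 p.2) := by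
  have := finrank_real_complex_fact'
  have hz : ContMDiff ((𝓡 1).prod (𝓡 3)) 𝓘(ℝ, ℂ) ∞ (fun p : Circle × S3 => (p.1 : ℂ)) :=
    (contMDiff_coe_sphere (E := ℂ) (n := 1)).comp contMDiff_fst
  have hv : ContMDiff ((𝓡 1).prod (𝓡 3)) 𝓘(ℝ, C2) ∞ (fun p : Circle × S3 => (p.2 : C2)) :=
    contMDiff_coe_sphere.comp contMDiff_snd
  have hg : ContDiff ℝ ∞ (fun p : ℂ × C2 => (!₂[p.1 ^ w₁ * p.2 0, p.1 ^ w₂ * p.2 1] : C2)) := by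
    have hc : ∀ i : Fin 2, ContDiff ℝ ∞ (fun p : ℂ × C2 => p.2 i) := fun i =>
      ((EuclideanSpace.proj i : C2 →L[ℂ] ℂ).restrictScalars ℝ).contDiff.comp contDiff_snd
    refine (PiLp.contDiff_toLp (𝕜 := ℝ)).comp (contDiff_pi.2 fun i => ?_)
    fin_cases i
    · exact (contDiff_fst.pow w₁).mul (hc 0)
    · exact (contDiff_fst.pow w₂).mul (hc 1)
  exact (hg.contMDiff.comp (hz.prodMk_space hv)).codRestrict_sphere _

theorem contMDiff_weightedRotation_const (w₁ w₂ : ℕ) (z : Circle) :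
    ContMDiff (𝓡 3) (𝓡 3) ∞ (weightedRotation w₁ w₂ z) :=
  (contMDiff_weightedRotation w₁ w₂).comp (contMDiff_const.prodMk contMDiff_id)

theorem weightedRotation_mul (w₁ w₂ : ℕ) (a b : Circle) (v : S3) :
    weightedRotation w₁ w₂ (a * b) v = weightedRotation w₁ w₂ a (weightedRotation w₁ w₂ b v) :=
  (weightedAction w₁ w₂).mul_smul a b v

theorem weightedRotation_one (w₁ w₂ : ℕ) (v : S3) : weightedRotation w₁ w₂ 1 v = v :=
  (weightedAction w₁ w₂).one_smul v

theorem weightedRotation_inv_cancel (w₁ w₂ : ℕ) (z : Circle) (v : S3) :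
    weightedRotation w₁ w₂ z⁻¹ (weightedRotation w₁ w₂ z v) = v := by
  rw [← weightedRotation_mul, inv_mul_cancel, weightedRotation_one]

/-- The circle has a smooth `l`-th root near each of its points. -/
theorem Circle.exists_contMDiffAt_root {l : ℕ} (hl : l ≠ 0) (s₀ : Circle) :
    ∃ ρ : Circle → Circle, (∀ s, ρ s ^ l = s) ∧ ContMDiffAt (𝓡 1) (𝓡 1) ∞ ρ s₀ := by
  have := finrank_real_complex_fact'
  have hroot : ∀ s : Circle, Circle.exp (Complex.arg s / l) ^ l = s := fun s => by
    rw [← Circle.exp_nsmul, nsmul_eq_mul, mul_div_cancel₀ _ (by exact_mod_cast hl), Circle.exp_arg]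
  -- The argument jumps at `-1`, so `s` is first rotated by `s₀⁻¹`, which brings it near `1`; a
  -- fixed root of `s₀` undoes the rotation. The root identity holds on the branch cut too.
  refine ⟨fun s => Circle.exp (Complex.arg ((s * s₀⁻¹ : Circle) : ℂ) / l) *
    Circle.exp (Complex.arg s₀ / l), fun s => ?_, ?_⟩
  · rw [mul_pow, hroot, hroot, inv_mul_cancel_right]
  · have h1 : ContMDiff (𝓡 1) 𝓘(ℝ, ℂ) ∞ (fun s : Circle => ((s * s₀⁻¹ : Circle) : ℂ)) :=
      (contMDiff_coe_sphere (E := ℂ) (n := 1)).comp (contMDiff_id.mul contMDiff_const)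
    have h2 : ContDiffAt ℝ ∞ (fun z : ℂ => Complex.arg z / l) ((s₀ * s₀⁻¹ : Circle) : ℂ) := by
      have h : ContDiffAt ℝ ∞ Complex.log ((s₀ * s₀⁻¹ : Circle) : ℂ) :=
        (Complex.contDiffAt_log (by simp)).restrict_scalars ℝ
      have h' : ContDiffAt ℝ ∞ (fun z : ℂ => (Complex.log z).im) ((s₀ * s₀⁻¹ : Circle) : ℂ) :=
        Complex.imCLM.contDiff.contDiffAt.comp _ h
      simpa only [Complex.log_im] using h'.div_const (l : ℝ)
    exact ((contMDiff_circleExp.contMDiffAt.comp s₀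
      (h2.contMDiffAt.comp s₀ h1.contMDiffAt))).mul contMDiffAt_const

theorem finite_circleRoots {l : ℕ} (hl : 0 < l) : Finite (circleRoots l) := by
  have : Finite {z : ℂ // z ∈ Polynomial.nthRootsFinset l (1 : ℂ)} := inferInstance
  refine Finite.of_injective (β := {z : ℂ // z ∈ Polynomial.nthRootsFinset l (1 : ℂ)})
    (fun ζ => ⟨(ζ : Circle), ?_⟩) fun a b h => ?_
  · rw [Polynomial.mem_nthRootsFinset hl, ← Circle.coe_pow]
    exact congrArg _ (MonoidHom.mem_ker.1 ζ.2)
  · exact Subtype.ext (Circle.ext (Subtype.mk.inj h))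

/-- A circle element of order prime to the weights acts freely. -/
theorem eq_one_of_weightedRotation_eq {l w₁ w₂ : ℕ} (hlw : Nat.Coprime l (w₁ * w₂))
    {z : Circle} (hz : z ^ l = 1) {v : S3} (hv : weightedRotation w₁ w₂ z v = v) : z = 1 := by
  -- Some coordinate of `v` is nonzero, which forces `z ^ w = 1` for the corresponding weight `w`;
  -- with `z ^ l = 1` and coprimality this gives `z = 1`.
  have key : ∀ w, Nat.Coprime l w → (z : ℂ) ^ w = 1 → z = 1 := fun w hw h => by
    have h' : z ^ w = 1 := Circle.ext (by simpa using h)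
    have := pow_gcd_eq_one.2 ⟨hz, h'⟩
    rwa [hw.gcd_eq_one, pow_one] at this
  have h0 : (z : ℂ) ^ w₁ * v.1 0 = v.1 0 := congrArg (fun u : S3 => u.1 0) hv
  have h1 : (z : ℂ) ^ w₂ * v.1 1 = v.1 1 := congrArg (fun u : S3 => u.1 1) hv
  by_cases hv0 : v.1 0 = 0
  · by_cases hv1 : v.1 1 = 0
    · have : v.1 = 0 := by ext i; fin_cases i <;> simp [hv0, hv1]
      have hn : ‖v.1‖ = 1 := mem_sphere_zero_iff_norm.1 v.2
      simp [this] at hn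
    · exact key w₂ hlw.coprime_mul_left_right (mul_right_cancel₀ hv1 (by rw [h1, one_mul]))
  · exact key w₁ hlw.coprime_mul_right_right (mul_right_cancel₀ hv0 (by rw [h0, one_mul]))

/-! ### The lens space -/

theorem LensSpace.mk_eq_mk {l w₁ w₂ : ℕ} {v v' : S3} :
    LensSpace.mk l w₁ w₂ v = LensSpace.mk l w₁ w₂ v' ↔
      ∃ ζ : Circle, ζ ^ l = 1 ∧ weightedRotation w₁ w₂ ζ v' = v :=
  Quotient.eq.trans (lensSetoid_iff l w₁ w₂ v v')

/-- The group of roots of unity is finite, hence acts properly discontinuously, and it acts freely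
by `eq_one_of_weightedRotation_eq`. The local inverses of this covering serve as charts with values
in `S³`. -/
theorem isQuotientCoveringMap_lensSpaceMk {l w₁ w₂ : ℕ} (hl : 0 < l)
    (hlw : Nat.Coprime l (w₁ * w₂)) :
    letI := weightedAction w₁ w₂
    IsQuotientCoveringMap (LensSpace.mk l w₁ w₂) (circleRoots l) := by
  let _ := weightedAction w₁ w₂
  have := finite_circleRoots hl
  have : ContinuousConstSMul (circleRoots l) S3 :=
    ⟨fun z => (contMDiff_weightedRotation_const w₁ w₂ z).continuous⟩
  have : ProperlyDiscontinuousSMul (circleRoots l) S3 := ⟨fun _ _ => Set.toFinite _⟩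
  have : IsCancelSMul (circleRoots l) S3 := ⟨fun a b v h => by
    have h' : weightedRotation w₁ w₂ a v = weightedRotation w₁ w₂ b v := h
    have hab : ((a⁻¹ * b : circleRoots l) : Circle) = 1 :=
      eq_one_of_weightedRotation_eq hlw (MonoidHom.mem_ker.1 (a⁻¹ * b : circleRoots l).2) (v := v)
        (by
          rw [Subgroup.coe_mul, Subgroup.coe_inv, weightedRotation_mul, ← h',
            weightedRotation_inv_cancel])
    exact (inv_mul_eq_one.1 (Subtype.ext hab))⟩
  exact isQuotientCoveringMap_quotientMk_of_properlyDiscontinuousSMul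

theorem t2Space_lensSpace {l : ℕ} (hl : 0 < l) (w₁ w₂ : ℕ) : T2Space (LensSpace l w₁ w₂) := by
  let _ := weightedAction w₁ w₂
  have := finite_circleRoots hl
  have : ContinuousConstSMul (circleRoots l) S3 :=
    ⟨fun z => (contMDiff_weightedRotation_const w₁ w₂ z).continuous⟩
  have : ProperlyDiscontinuousSMul (circleRoots l) S3 := ⟨fun _ _ => Set.toFinite _⟩
  exact t2Space_of_properlyDiscontinuousSMul_of_t2Space (Γ := circleRoots l) (T := S3)

theorem secondCountableTopology_lensSpace (l w₁ w₂ : ℕ) :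
    SecondCountableTopology (LensSpace l w₁ w₂) := by
  let _ := weightedAction w₁ w₂
  have : ContinuousConstSMul (circleRoots l) S3 :=
    ⟨fun z => (contMDiff_weightedRotation_const w₁ w₂ z).continuous⟩
  exact ContinuousConstSMul.secondCountableTopology (Γ := circleRoots l) (T := S3)

/-- The lens space is a smooth manifold, and `S³ → L(l; w₁, w₂)` is a submersion with smooth
local sections. -/
theorem exists_isQuotientManifold_lensSpace {l w₁ w₂ : ℕ} (hl : 0 < l)
    (hlw : Nat.Coprime l (w₁ * w₂)) :
    ∃ _ : ChartedSpace (EuclideanSpace ℝ (Fin 3)) (LensSpace l w₁ w₂),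
      IsQuotientManifold (𝓡 3) (𝓡 3) (LensSpace.mk l w₁ w₂) ∧
      ∀ v : S3, ∃ τ : LensSpace l w₁ w₂ → S3, τ (LensSpace.mk l w₁ w₂ v) = v ∧
        ContMDiffAt (𝓡 3) (𝓡 3) ∞ τ (LensSpace.mk l w₁ w₂ v) ∧
        ∀ᶠ y in 𝓝 (LensSpace.mk l w₁ w₂ v), LensSpace.mk l w₁ w₂ (τ y) = y := by
  let _ := weightedAction w₁ w₂
  have hcov := isQuotientCoveringMap_lensSpaceMk hl hlw
  have := t2Space_lensSpace hl w₁ w₂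
  have := secondCountableTopology_lensSpace l w₁ w₂
  choose e he hev using hcov.isCoveringMap.isLocalHomeomorph
  have hsurj : Function.Surjective (LensSpace.mk l w₁ w₂) := hcov.surjective
  choose r hr using hsurj
  have hoe : ∀ v x, e v x = LensSpace.mk l w₁ w₂ x := fun v x => (congrFun (hev v) x).symm
  obtain ⟨cs, hq, -, hτ⟩ := exists_isQuotientManifold (𝓡 3) (𝓡 3)
    (ContinuousLinearEquiv.refl ℝ (EuclideanSpace ℝ (Fin 3))) hcov.toIsQuotientMap
    (fun y => (e (r y)).symm)
    (fun y => by simpa [hoe, hr] using (e (r y)).map_source (he (r y)))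
    (fun y x hx => by
      -- The point `x` and its image under the local inverse lie over the same point of the lens
      -- space, so they differ by a root of unity `ζ`. Near `x` the local inverse composed with the
      -- quotient map is the rotation by `ζ`; the rotation by `ζ⁻¹` is the section required
      -- afterwards.
      obtain ⟨ζ, hζ, hζx⟩ := LensSpace.mk_eq_mk.1
        ((hoe (r y) _).symm.trans ((e (r y)).right_inv hx))
      have hsrc : weightedRotation w₁ w₂ ζ x ∈ (e (r y)).source :=
        hζx ▸ (e (r y)).map_target hx
      refine (contMDiff_weightedRotation_const w₁ w₂ ζ x).congr_of_eventuallyEq ?_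
      filter_upwards [(contMDiff_weightedRotation_const w₁ w₂ ζ).continuous.continuousAt
        |>.preimage_mem_nhds ((e (r y)).open_source.mem_nhds hsrc)] with x' hx'
      have : LensSpace.mk l w₁ w₂ x' = e (r y) (weightedRotation w₁ w₂ ζ x') := by
        rw [hoe]
        exact (LensSpace.mk_eq_mk.2 ⟨ζ, hζ, rfl⟩).symm
      rw [Function.comp_apply, this]
      exact (e (r y)).left_inv hx')
    (fun y x hx => by
      obtain ⟨ζ, hζ, hζx⟩ := LensSpace.mk_eq_mk.1
        ((hoe (r y) _).symm.trans ((e (r y)).right_inv hx))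
      refine ⟨weightedRotation w₁ w₂ ζ⁻¹, ?_, contMDiff_weightedRotation_const w₁ w₂ ζ⁻¹ _,
        Eventually.of_forall fun n => ?_⟩
      · rw [← hζx, weightedRotation_inv_cancel]
      · rw [OpenPartialHomeomorph.symm_symm, hoe]
        exact LensSpace.mk_eq_mk.2 ⟨ζ⁻¹, by rw [inv_pow, hζ, inv_one], rfl⟩)
  exact ⟨cs, hq, hτ⟩

/-! ### Topological trivializations of the join -/

/-- The total space of a locally trivial bundle with Hausdorff base and fibre is Hausdorff. -/
theorem t2Space_of_trivialization {B F Z : Type*} [TopologicalSpace B] [TopologicalSpace F]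
    [TopologicalSpace Z] [T2Space B] [T2Space F] {p : Z → B}
    (h : ∀ b, ∃ e : Bundle.Trivialization F p, b ∈ e.baseSet) : T2Space Z := by
  have hp : Continuous p := continuous_iff_continuousAt.2 fun x => by
    obtain ⟨e, he⟩ := h (p x)
    exact e.continuousAt_proj (e.mem_source.2 he)
  refine ⟨fun x y hxy => ?_⟩
  by_cases hpxy : p x = p y
  · obtain ⟨e, he⟩ := h (p x)
    have hx : x ∈ e.source := e.mem_source.2 he
    have hy : y ∈ e.source := e.mem_source.2 (hpxy ▸ he)
    obtain ⟨u, v, hu, hv, hxu, hyv, huv⟩ :=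
      t2_separation (e.toOpenPartialHomeomorph.injOn.ne hx hy hxy)
    exact ⟨_, _, e.toOpenPartialHomeomorph.isOpen_inter_preimage hu,
      e.toOpenPartialHomeomorph.isOpen_inter_preimage hv, ⟨hx, hxu⟩, ⟨hy, hyv⟩,
      (huv.preimage _).mono inter_subset_right inter_subset_right⟩
  · exact separated_by_continuous hp hpxy

section EquivariantTrivialization

variable {P B : Type*} [TopologicalSpace P] [MulAction Circle P] [TopologicalSpace B] {π : P → B}
  {e : Bundle.Trivialization Circle π}

/-- The inverse of an equivariant trivialization is equivariant. -/
theorem smul_trivialization_symm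
    (he : ∀ x ∈ e.source, ∀ z : Circle, z • x ∈ e.source ∧ e (z • x) = ((e x).1, z * (e x).2))
    {b : B} (hb : b ∈ e.baseSet) (z s : Circle) :
    z • e.toOpenPartialHomeomorph.symm (b, s) = e.toOpenPartialHomeomorph.symm (b, z * s) := by
  have ht : (b, s) ∈ e.target := e.mem_target.2 hb
  obtain ⟨h1, h2⟩ := he _ (e.map_target ht) z
  rw [e.apply_symm_apply ht] at h2
  rw [← e.toOpenPartialHomeomorph.left_inv h1]
  exact congrArg _ h2

/-- In the trivialization the action is multiplication on the circle factor. Continuity of the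
action makes the quotient map to the join open. -/
theorem continuousAt_smul_of_trivialization
    (he : ∀ x ∈ e.source, ∀ z : Circle, z • x ∈ e.source ∧ e (z • x) = ((e x).1, z * (e x).2))
    (z : Circle) {x : P} (hx : x ∈ e.source) : ContinuousAt (z • · : P → P) x := by
  have h1 : ContinuousAt e x := e.toOpenPartialHomeomorph.continuousAt hx
  have h2 : ContinuousAt e.toOpenPartialHomeomorph.symm ((e x).1, z * (e x).2) :=
    e.toOpenPartialHomeomorph.symm.continuousAt
      ((he x hx z).2 ▸ e.toOpenPartialHomeomorph.map_source (he x hx z).1)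
  refine (ContinuousAt.comp (f := fun x => ((e x).1, z * (e x).2)) h2
    (h1.fst.prodMk (continuousAt_const.mul h1.snd))).congr ?_
  filter_upwards [e.open_source.mem_nhds hx] with y hy
  rw [Function.comp_apply, ← (he y hy z).2]
  exact e.toOpenPartialHomeomorph.left_inv (he y hy z).1

end EquivariantTrivialization

theorem IsSmoothPrincipalCircleBundle.continuousConstSMul
    {EP HP EB HB : Type*}
    [NormedAddCommGroup EP] [NormedSpace ℝ EP] [TopologicalSpace HP]
    [NormedAddCommGroup EB] [NormedSpace ℝ EB] [TopologicalSpace HB]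
    {IP : ModelWithCorners ℝ EP HP} {IB : ModelWithCorners ℝ EB HB}
    {P B : Type*}
    [TopologicalSpace P] [ChartedSpace HP P] [MulAction Circle P]
    [TopologicalSpace B] [ChartedSpace HB B]
    {π : P → B} (h : IsSmoothPrincipalCircleBundle IP IB π) : ContinuousConstSMul Circle P :=
  ⟨fun z => continuous_iff_continuousAt.2 fun x => by
    obtain ⟨e, hb, -, -, he⟩ := h (π x)
    exact continuousAt_smul_of_trivialization he z (e.mem_source.2 hb)⟩

section Join

variable {P B : Type*} [MulAction Circle P]

theorem SasakiJoin.mk_eq_mk {l w₁ w₂ : ℕ} {x y : P × S3} :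
    SasakiJoin.mk P l w₁ w₂ x = SasakiJoin.mk P l w₁ w₂ y ↔
      ∃ z : Circle, ((z ^ l)⁻¹ • y.1, weightedRotation w₁ w₂ z y.2) = x :=
  Quotient.eq.trans (joinSetoid_iff P l w₁ w₂ x y)

variable [TopologicalSpace P]

theorem isOpenQuotientMap_sasakiJoinMk [ContinuousConstSMul Circle P] (l w₁ w₂ : ℕ) :
    IsOpenQuotientMap (SasakiJoin.mk P l w₁ w₂) := by
  let _ := joinAction P l w₁ w₂
  have : ContinuousConstSMul Circle (P × S3) := ⟨fun z =>
    ((continuous_const_smul (z ^ l)⁻¹).comp continuous_fst).prodMk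
      ((contMDiff_weightedRotation_const w₁ w₂ z).continuous.comp continuous_snd)⟩
  exact MulAction.isOpenQuotientMap_quotientMk

theorem isOpenQuotientMap_lensSpaceMk (l w₁ w₂ : ℕ) :
    IsOpenQuotientMap (LensSpace.mk l w₁ w₂) := by
  let _ := weightedAction w₁ w₂
  have : ContinuousConstSMul (circleRoots l) S3 :=
    ⟨fun z => (contMDiff_weightedRotation_const w₁ w₂ z).continuous⟩
  exact MulAction.isOpenQuotientMap_quotientMk

/-- Points of `S³` that are rotated by two `l`-th roots of the same element agree in the lens
space. -/
theorem LensSpace.mk_weightedRotation_eq {l w₁ w₂ : ℕ} {ζ ξ : Circle} (h : ζ ^ l = ξ ^ l)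
    (v : S3) :
    LensSpace.mk l w₁ w₂ (weightedRotation w₁ w₂ ζ v) =
      LensSpace.mk l w₁ w₂ (weightedRotation w₁ w₂ ξ v) :=
  LensSpace.mk_eq_mk.2 ⟨ζ * ξ⁻¹, by rw [mul_pow, inv_pow, h, mul_inv_cancel], by
    rw [← weightedRotation_mul, inv_mul_cancel_right]⟩

/-- An equivariant trivialization of a circle bundle induces a trivialization of the join, with the
lens space as fibre. -/
theorem exists_trivialization_sasakiJoin [TopologicalSpace B] [ContinuousConstSMul Circle P]
    {π : P → B} (hπ : ∀ (z : Circle) (u : P), π (z • u) = π u)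
    {l : ℕ} (hl : l ≠ 0) (w₁ w₂ : ℕ) {e : Bundle.Trivialization Circle π}
    (he : ∀ x ∈ e.source, ∀ z : Circle, z • x ∈ e.source ∧ e (z • x) = ((e x).1, z * (e x).2)) :
    ∃ Φ : Bundle.Trivialization (LensSpace l w₁ w₂) (SasakiJoin.proj hπ l w₁ w₂),
      Φ.baseSet = e.baseSet ∧
      (∀ u v ζ, π u ∈ e.baseSet → ζ ^ l = (e u).2 → Φ (SasakiJoin.mk P l w₁ w₂ (u, v)) =
        (π u, LensSpace.mk l w₁ w₂ (weightedRotation w₁ w₂ ζ v))) ∧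
      ∀ b v, b ∈ e.baseSet →
        Φ.toOpenPartialHomeomorph.symm (b, LensSpace.mk l w₁ w₂ v) =
          SasakiJoin.mk P l w₁ w₂ (e.toOpenPartialHomeomorph.symm (b, 1), v) := by
  choose root hroot hsmooth using fun s : Circle => Circle.exists_contMDiffAt_root hl s
  have hJ := isOpenQuotientMap_sasakiJoinMk (P := P) l w₁ w₂
  have hL := isOpenQuotientMap_lensSpaceMk l w₁ w₂
  let r : SasakiJoin P l w₁ w₂ → P × S3 := Function.surjInv hJ.surjective
  let t : LensSpace l w₁ w₂ → S3 := Function.surjInv hL.surjective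
  have hr : ∀ y, SasakiJoin.mk P l w₁ w₂ (r y) = y := Function.surjInv_eq hJ.surjective
  have ht : ∀ y, LensSpace.mk l w₁ w₂ (t y) = y := Function.surjInv_eq hL.surjective
  -- The representative `r y` and the root `root 1` need not vary continuously. By `hf`, every
  -- representative over the base set and every root give the same value, so a locally smooth choice
  -- can be substituted where continuity is proved.
  let f : SasakiJoin P l w₁ w₂ → B × LensSpace l w₁ w₂ := fun y =>
    (SasakiJoin.proj hπ l w₁ w₂ y,
      LensSpace.mk l w₁ w₂ (weightedRotation w₁ w₂ (root 1 (e (r y).1).2) (r y).2))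
  let g : B × LensSpace l w₁ w₂ → SasakiJoin P l w₁ w₂ := fun x =>
    SasakiJoin.mk P l w₁ w₂ (e.toOpenPartialHomeomorph.symm (x.1, 1), t x.2)
  have hf : ∀ u v ζ, π u ∈ e.baseSet → ζ ^ l = (e u).2 → f (SasakiJoin.mk P l w₁ w₂ (u, v)) =
      (π u, LensSpace.mk l w₁ w₂ (weightedRotation w₁ w₂ ζ v)) := by
    intro u v ζ hu hζ
    obtain ⟨z, hz⟩ := SasakiJoin.mk_eq_mk.1 (hr (SasakiJoin.mk P l w₁ w₂ (u, v)))
    refine Prod.ext rfl ?_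
    simp only [f, ← hz, ← weightedRotation_mul]
    -- The chosen representative is `z · (u, v)`. With `s` the circle coordinate of `u`, its circle
    -- coordinate is `z^(-l) s`, so a root of that times `z` is an `l`-th root of `s`, just as `ζ`
    -- is.
    refine LensSpace.mk_weightedRotation_eq ?_ v
    rw [mul_pow, hroot, (he u (e.mem_source.2 hu) _).2, hζ, mul_right_comm, inv_mul_cancel, one_mul]
  have hg : ∀ b v, b ∈ e.baseSet → g (b, LensSpace.mk l w₁ w₂ v) =
      SasakiJoin.mk P l w₁ w₂ (e.toOpenPartialHomeomorph.symm (b, 1), v) := by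
    intro b v hb
    obtain ⟨ζ, hζ, hv⟩ := LensSpace.mk_eq_mk.1 (ht (LensSpace.mk l w₁ w₂ v))
    exact SasakiJoin.mk_eq_mk.2 ⟨ζ, by simp [hζ, hv]⟩
  have hfg : ∀ u v, π u ∈ e.baseSet → g (f (SasakiJoin.mk P l w₁ w₂ (u, v))) =
      SasakiJoin.mk P l w₁ w₂ (u, v) := by
    intro u v hu
    rw [hf u v _ hu (hroot 1 _), hg _ _ hu]
    refine SasakiJoin.mk_eq_mk.2 ⟨root 1 (e u).2, ?_⟩
    rw [hroot]
    refine Prod.ext ?_ rfl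
    -- Dividing `u` by its circle coordinate moves it to the slice where this coordinate is `1`.
    have : e.toOpenPartialHomeomorph.symm (π u, 1) = (e u).2⁻¹ • u := by
      have h := smul_trivialization_symm he hu (e u).2⁻¹ (e u).2
      rw [e.symm_apply_mk_proj (e.mem_source.2 hu), inv_mul_cancel] at h
      exact h.symm
    exact this.symm
  have hgf : ∀ b v, b ∈ e.baseSet → f (g (b, LensSpace.mk l w₁ w₂ v)) =
      (b, LensSpace.mk l w₁ w₂ v) := by
    intro b v hb
    have h1 : e (e.toOpenPartialHomeomorph.symm (b, 1)) = (b, 1) := e.apply_symm_apply' hb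
    have h2 : π (e.toOpenPartialHomeomorph.symm (b, 1)) = b := e.proj_symm_apply' hb
    rw [hg b v hb, hf _ v 1 (by rwa [h2]) (by rw [h1, one_pow]), h2, weightedRotation_one]
  refine ⟨{ toFun := f
            invFun := g
            source := SasakiJoin.proj hπ l w₁ w₂ ⁻¹' e.baseSet
            target := e.baseSet ×ˢ univ
            map_source' := fun y hy => ⟨hy, trivial⟩
            map_target' := ?_
            left_inv' := ?_
            right_inv' := ?_
            open_source := ?_
            open_target := e.open_baseSet.prod isOpen_univ
            continuousOn_toFun := ?_
            continuousOn_invFun := ?_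
            baseSet := e.baseSet
            open_baseSet := e.open_baseSet
            source_eq := rfl
            target_eq := rfl
            proj_toFun := fun _ _ => rfl }, rfl, hf, hg⟩
  · rintro ⟨b, y⟩ ⟨hb, -⟩
    change π (e.toOpenPartialHomeomorph.symm (b, 1)) ∈ e.baseSet
    rwa [e.proj_symm_apply' hb]
  · intro y hy
    obtain ⟨⟨u, v⟩, rfl⟩ := hJ.surjective y
    exact hfg u v hy
  · rintro ⟨b, y⟩ ⟨hb, -⟩
    obtain ⟨v, rfl⟩ := hL.surjective y
    exact hgf b v hb
  · intro y hy
    obtain ⟨⟨u, v⟩, rfl⟩ := hJ.surjective y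
    have hu : u ∈ e.source := e.mem_source.2 hy
    refine ContinuousAt.continuousWithinAt (hJ.continuousAt_comp_iff.1 ?_)
    have h1 : ContinuousAt (fun x : P × S3 => e x.1) (u, v) :=
      ContinuousAt.comp (f := Prod.fst) (e.toOpenPartialHomeomorph.continuousAt hu)
        continuousAt_fst
    -- Here the root is the one that is smooth near the circle coordinate of `u`.
    have h2 : ContinuousAt (fun x : P × S3 => root (e u).2 (e x.1).2) (u, v) :=
      ContinuousAt.comp (f := fun x : P × S3 => (e x.1).2) (g := root (e u).2)
        (hsmooth (e u).2).continuousAt h1.snd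
    have h3 : ContinuousAt (fun x : P × S3 => ((e x.1).1, LensSpace.mk l w₁ w₂
        (weightedRotation w₁ w₂ (root (e u).2 (e x.1).2) x.2))) (u, v) :=
      h1.fst.prodMk (hL.continuous.continuousAt.comp
        (ContinuousAt.comp (f := fun x : P × S3 => (root (e u).2 (e x.1).2, x.2))
          (contMDiff_weightedRotation w₁ w₂).continuous.continuousAt
          (h2.prodMk continuousAt_snd)))
    refine h3.congr ?_
    filter_upwards [continuousAt_fst.preimage_mem_nhds (e.open_source.mem_nhds hu)] with x hx
    rw [e.coe_fst hx]
    exact (hf x.1 x.2 _ (e.mem_source.1 hx) (hroot _ _)).symm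
  · rintro ⟨b, y⟩ ⟨hb, -⟩
    obtain ⟨v, rfl⟩ := hL.surjective y
    -- A product of quotient maps need not be a quotient map; openness of `S³ → L(l; w₁, w₂)` lets
    -- continuity descend along its product with the identity of `B`.
    refine ContinuousAt.continuousWithinAt
      (((IsOpenQuotientMap.id (X := B)).prodMap hL).continuousAt_comp_iff (x := (b, v)).1 ?_)
    have h1 : ContinuousAt (fun x : B × S3 => e.toOpenPartialHomeomorph.symm (x.1, 1)) (b, v) :=
      ContinuousAt.comp (f := fun x : B × S3 => (x.1, (1 : Circle)))
        (e.toOpenPartialHomeomorph.symm.continuousAt (e.mem_target.2 hb))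
        (continuousAt_fst.prodMk continuousAt_const)
    refine (hJ.continuous.continuousAt.comp (h1.prodMk continuousAt_snd)).congr ?_
    filter_upwards [continuousAt_fst.preimage_mem_nhds (e.open_baseSet.mem_nhds hb)] with x hx
    exact (hg x.1 x.2 hx).symm
  · refine hJ.isQuotientMap.isOpen_preimage.1 ?_
    change IsOpen ((fun x : P × S3 => π x.1) ⁻¹' e.baseSet)
    have : (fun x : P × S3 => π x.1) ⁻¹' e.baseSet = Prod.fst ⁻¹' e.source := by
      rw [e.source_eq]; rfl
    rw [this]
    exact e.open_source.preimage continuous_fst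

end Join

/-! ### Smooth structure of the join and the bundle theorem -/

/-- The join of a smooth principal circle bundle with the weighted `S³` is a smooth manifold, and
its projection to the base is a smooth fibre bundle with the lens space as fibre. -/
theorem IsSmoothPrincipalCircleBundle.exists_isQuotientManifold_sasakiJoin
    {EP HP EB HB E : Type*}
    [NormedAddCommGroup EP] [NormedSpace ℝ EP] [TopologicalSpace HP]
    [NormedAddCommGroup EB] [NormedSpace ℝ EB] [TopologicalSpace HB]
    [NormedAddCommGroup E] [NormedSpace ℝ E]
    {IP : ModelWithCorners ℝ EP HP} {IB : ModelWithCorners ℝ EB HB} [IB.Boundaryless]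
    {P B : Type*}
    [TopologicalSpace P] [SecondCountableTopology P] [ChartedSpace HP P] [MulAction Circle P]
    [TopologicalSpace B] [T2Space B] [ChartedSpace HB B] [IsManifold IB ∞ B]
    {π : P → B} (hπ : IsSmoothPrincipalCircleBundle IP IB π)
    {l w₁ w₂ : ℕ} (hl : l ≠ 0)
    [ChartedSpace (EuclideanSpace ℝ (Fin 3)) (LensSpace l w₁ w₂)]
    (hq : IsQuotientManifold (𝓡 3) (𝓡 3) (LensSpace.mk l w₁ w₂))
    (hτ : ∀ v : S3, ∃ τ : LensSpace l w₁ w₂ → S3, τ (LensSpace.mk l w₁ w₂ v) = v ∧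
      ContMDiffAt (𝓡 3) (𝓡 3) ∞ τ (LensSpace.mk l w₁ w₂ v) ∧
      ∀ᶠ y in 𝓝 (LensSpace.mk l w₁ w₂ v), LensSpace.mk l w₁ w₂ (τ y) = y)
    (L : (EB × EuclideanSpace ℝ (Fin 3)) ≃L[ℝ] E) :
    ∃ _ : ChartedSpace E (SasakiJoin P l w₁ w₂),
      IsQuotientManifold (IP.prod (𝓡 3)) 𝓘(ℝ, E) (SasakiJoin.mk P l w₁ w₂) ∧
      IsSmoothFiberBundle 𝓘(ℝ, E) IB (𝓡 3) (LensSpace l w₁ w₂)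
        (SasakiJoin.proj hπ.proj_smul l w₁ w₂) := by
  have := hπ.continuousConstSMul
  have := hq.t2
  have := hq.isManifold
  have hJ := isOpenQuotientMap_sasakiJoinMk (P := P) l w₁ w₂
  choose e hb hes het heq using id hπ
  choose Φ hΦb hΦ hΦs using fun b =>
    exists_trivialization_sasakiJoin hπ.proj_smul hl w₁ w₂ (heq b)
  have hmem : ∀ b, b ∈ (Φ b).baseSet := fun b => hΦb b ▸ hb b
  have : T2Space (SasakiJoin P l w₁ w₂) :=
    t2Space_of_trivialization fun b => ⟨Φ b, hmem b⟩
  have : SecondCountableTopology (SasakiJoin P l w₁ w₂) :=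
    hJ.isQuotientMap.secondCountableTopology hJ.isOpenMap
  have hsrc : ∀ b (x : P × S3), SasakiJoin.mk P l w₁ w₂ x ∈ (Φ b).source → x.1 ∈ (e b).source :=
    fun b x hx => (e b).mem_source.2 (hΦb b ▸ (Φ b).mem_source.1 hx)
  obtain ⟨cs, hQ, hΨ, -⟩ := exists_isQuotientManifold (IP.prod (𝓡 3)) (IB.prod (𝓡 3)) L
    hJ.isQuotientMap
    -- The family has to be indexed by points of the join, so each point takes the trivialization
    -- chosen at its image in `B`.
    (fun y => (Φ (SasakiJoin.proj hπ.proj_smul l w₁ w₂ y)).toOpenPartialHomeomorph)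
    (fun y => (Φ _).mem_source.2 (hmem _))
    (fun y x hx => by
      obtain ⟨b, hby⟩ : ∃ b, SasakiJoin.proj hπ.proj_smul l w₁ w₂ y = b := ⟨_, rfl⟩
      rw [hby] at hx ⊢
      have hu := hsrc b x hx
      obtain ⟨ρ, hρ, hρs⟩ := Circle.exists_contMDiffAt_root hl ((e b) x.1).2
      have h1 : ContMDiffAt (IP.prod (𝓡 3)) (IB.prod (𝓡 1)) ∞ (fun x : P × S3 => e b x.1) x :=
        ContMDiffAt.comp x ((hes b).contMDiffAt ((e b).open_source.mem_nhds hu)) contMDiffAt_fst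
      have h2 : ContMDiffAt (IP.prod (𝓡 3)) (𝓡 1) ∞ (fun x : P × S3 => ρ (e b x.1).2) x :=
        ContMDiffAt.comp x hρs h1.snd
      have h3 : ContMDiffAt (IP.prod (𝓡 3)) (𝓡 3) ∞ (fun x : P × S3 =>
          weightedRotation w₁ w₂ (ρ (e b x.1).2) x.2) x :=
        ContMDiffAt.comp (f := fun x : P × S3 => (ρ (e b x.1).2, x.2)) x
          (contMDiff_weightedRotation w₁ w₂).contMDiffAt (h2.prodMk contMDiffAt_snd)
      refine (h1.fst.prodMk (hq.contMDiff.contMDiffAt.comp x h3)).congr_of_eventuallyEq ?_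
      filter_upwards [continuousAt_fst.preimage_mem_nhds ((e b).open_source.mem_nhds hu)]
        with x' hx'
      rw [(e b).coe_fst hx']
      exact hΦ b x'.1 x'.2 _ ((e b).mem_source.1 hx') (hρ _))
    (fun y x hx => by
      obtain ⟨b, hby⟩ : ∃ b, SasakiJoin.proj hπ.proj_smul l w₁ w₂ y = b := ⟨_, rfl⟩
      rw [hby] at hx ⊢
      obtain ⟨u, v⟩ := x
      have hu := hsrc b _ hx
      have hub := (e b).mem_source.1 hu
      obtain ⟨ρ, hρ, -⟩ := Circle.exists_contMDiffAt_root hl 1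
      obtain ⟨s, hs⟩ : ∃ s, (e b u).2 = s := ⟨_, rfl⟩
      obtain ⟨ζ, hζ⟩ : ∃ ζ : Circle, ζ ^ l = s := ⟨ρ s, hρ s⟩
      have hval : (Φ b).toOpenPartialHomeomorph (SasakiJoin.mk P l w₁ w₂ (u, v)) =
          (π u, LensSpace.mk l w₁ w₂ (weightedRotation w₁ w₂ ζ v)) :=
        hΦ b u v ζ hub (hζ.trans hs.symm)
      obtain ⟨τ, h1, h2, h3⟩ := hτ (weightedRotation w₁ w₂ ζ v)
      rw [hval]
      -- The inverse of `Φ b` lifts naturally to the slice with circle coordinate `1`. The action of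
      -- `ζ⁻¹` moves that lift to the slice with coordinate `s = ζ ^ l`, so that it passes through
      -- `(u, v)` without changing classes.
      refine ⟨fun n => ((e b).toOpenPartialHomeomorph.symm (n.1, s),
        weightedRotation w₁ w₂ ζ⁻¹ (τ n.2)), ?_, ?_, ?_⟩
      · refine Prod.ext ?_ ?_
        · change (e b).toOpenPartialHomeomorph.symm (π u, s) = u
          rw [← hs, (e b).symm_apply_mk_proj hu]
        · change weightedRotation w₁ w₂ ζ⁻¹ (τ _) = v
          rw [h1, weightedRotation_inv_cancel]
      · have h4 : ContMDiffAt (IB.prod (𝓡 1)) IP ∞ (e b).toOpenPartialHomeomorph.symm (π u, s) :=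
          (het b).contMDiffAt ((e b).open_target.mem_nhds ((e b).mem_target.2 hub))
        exact (ContMDiffAt.comp
            (f := fun n : B × LensSpace l w₁ w₂ => (n.1, s))
            (π u, LensSpace.mk l w₁ w₂ (weightedRotation w₁ w₂ ζ v)) h4
            (contMDiffAt_fst.prodMk contMDiffAt_const)).prodMk
          ((contMDiff_weightedRotation_const w₁ w₂ ζ⁻¹).contMDiffAt.comp _
            (ContMDiffAt.comp (f := Prod.snd) (_, _) h2 contMDiffAt_snd))
      · filter_upwards [continuousAt_fst.preimage_mem_nhds ((e b).open_baseSet.mem_nhds hub),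
          continuousAt_snd.eventually h3] with n hn hn'
        obtain ⟨c, y'⟩ := n
        have hy' : LensSpace.mk l w₁ w₂ (τ y') = y' := hn'
        have := hΦs b c (τ y') hn
        rw [hy'] at this
        rw [this]
        refine SasakiJoin.mk_eq_mk.2 ⟨ζ⁻¹, Prod.ext ?_ rfl⟩
        change ((ζ⁻¹) ^ l)⁻¹ • (e b).toOpenPartialHomeomorph.symm (c, 1) = _
        rw [inv_pow, inv_inv, hζ, smul_trivialization_symm (heq b) hn, mul_one])
  refine ⟨cs, hQ, fun b => ⟨Φ b, hmem b, ?_⟩⟩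
  -- Smoothness of the trivializations is known only at indices that are points of the join; since
  -- the fibre is nonempty, every `b` is the image of such a point.
  obtain ⟨y, rfl⟩ : ∃ y, SasakiJoin.proj hπ.proj_smul l w₁ w₂ y = b := by
    have : Nonempty (LensSpace l w₁ w₂) :=
      (NormedSpace.sphere_nonempty (E := C2) (x := 0).2 zero_le_one).to_subtype.map
        (LensSpace.mk l w₁ w₂)
    obtain ⟨y, -, hy⟩ := (Φ b).proj_surjOn_baseSet (hmem b)
    exact ⟨y, hy⟩
  exact hΨ y

theorem proposition3p1
    {S P : Type*}
    [TopologicalSpace S] [T2Space S] [CompactSpace S] [ConnectedSpace S]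
    [ChartedSpace (EuclideanSpace ℝ (Fin 2)) S] [IsManifold (𝓡 2) ∞ S]
    [TopologicalSpace P] [T2Space P] [SecondCountableTopology P]
    [ChartedSpace (EuclideanSpace ℝ (Fin 3)) P] [IsManifold (𝓡 3) ∞ P]
    [MulAction Circle P] {π : P → S}
    (hπ : IsSmoothPrincipalCircleBundle (𝓡 3) (𝓡 2) π)
    (l₂ w₁ w₂ : ℕ) (hl₂ : 0 < l₂) (hw₁ : 0 < w₁) (hw₂ : 0 < w₂)
    (hw : Nat.Coprime w₁ w₂) (hlw : Nat.Coprime l₂ (w₁ * w₂)) :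
    ∃ (_ : ChartedSpace (EuclideanSpace ℝ (Fin 5)) (SasakiJoin P l₂ w₁ w₂))
      (_ : ChartedSpace (EuclideanSpace ℝ (Fin 3)) (LensSpace l₂ w₁ w₂)),
      IsQuotientManifold ((𝓡 3).prod (𝓡 3)) (𝓡 5) (SasakiJoin.mk P l₂ w₁ w₂) ∧
      IsQuotientManifold (𝓡 3) (𝓡 3) (LensSpace.mk l₂ w₁ w₂) ∧
      IsSmoothFiberBundle (𝓡 5) (𝓡 2) (𝓡 3) (LensSpace l₂ w₁ w₂)
        (SasakiJoin.proj hπ.proj_smul l₂ w₁ w₂) := by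
  obtain ⟨cL, hq, hτ⟩ := exists_isQuotientManifold_lensSpace hl₂ hlw
  -- The charts of base and fibre give `ℝ² × ℝ³`, which any linear isomorphism identifies with `ℝ⁵`.
  obtain ⟨cJ, hJ, hbundle⟩ := hπ.exists_isQuotientManifold_sasakiJoin hl₂.ne' hq hτ
    (ContinuousLinearEquiv.ofFinrankEq (F := EuclideanSpace ℝ (Fin 5)) (by simp))
  exact ⟨cJ, cL, hJ, hq, hbundle⟩
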